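/- Let $\omega_{st}=\frac i2\sum_{k=1}^8 dz_k\wedge d\bar z_k$ be the standard symplectic form on $\mathbb C^8$, and let $\mathcal L=(\mathcal L_1,\dots,\mathcal L_6):\mathbb C^8\to\mathbb R^6$ be $$\mathcal L(z)=-\tfrac12\begin{pmatrix}|z_1|^2+|z_5|^2-6\\ |z_2|^2+|z_5|^2+|z_7|^2-10\\ |z_3|^2+|z_7|^2-6\\ |z_4|^2-|z_5|^2+|z_7|^2-4\\ |z_5|^2-|z_6|^2+|z_7|^2-2\\ |z_5|^2-|z_7|^2+|z_8|^2-4\end{pmatrix}.$$ The Hamiltonian flows of the components of $\mathcal L$ generate an action of the torus $\mathbb T^6$, which is free on $\mathcal L^{-1}(0)$. Let $(M,\omega)$, $M=\mathcal L^{-1}(0)/\mathbb T^6$, be the symplectic quotient, i.e. the $4$-dimensional manifold whose symplectic form is determined by $\tau^*\omega=\kappa^*\omega_{st}$ for the quotient map $\tau:\mathcal L^{-1}(0)\to M$ and the inclusion $\kappa:\mathcal L^{-1}(0)\to\mathbb C^8$. Consider on $\mathbb C^8$ the functions $J=\frac12|z_1|^2$, $H=\frac12|z_3|^2$, $$\gamma_1=\tfrac1{50}\,\mathrm{Re}\,(\overline{z_2z_3z_4}\,z_6z_7z_8),\quad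 \gamma_2=\tfrac1{50}|z_5|^4|z_4|^4,\quad \gamma_3=\tfrac1{50}|z_4|^4|z_7|^4,\quad \gamma_4=\tfrac1{100}|z_5|^4|z_7|^4,$$ and, for $t=(t_1,t_2,t_3,t_4)\in\mathbb R^4$, $H_t=(1-2t_1)H+\sum_{j=1}^4t_j\gamma_j$. These functions are $\mathbb T^6$-invariant; the functions that they induce on $M$ are denoted by the same symbols. For a smooth function $f$ on a symplectic manifold $(X,\Omega)$ let $X^f$ be its Hamiltonian vector field, $\Omega(X^f,\cdot)=df$, and let $\{g,h\}=\Omega(X^g,X^h)$ be the Poisson bracket. Then $J$, $\gamma_1,\dots,\gamma_4$ and $H_t$ are smooth functions on $M$, and on $(M,\omega)$ one has $\{\gamma_j,J\}=0$ for $j=1,2,3,4$ and $\{H_t,J\}=0$ for all $t\in\mathbb R^4$. Likewise, the corresponding functions on $\mathbb C^8$ are smooth, and $\{\gamma_j,J\}=0$ for $j=1,2,3,4$ and $\{H_t,J\}=0$ for all $t\in\mathbb R^4$ on $(\mathbb C^8,\omega_{st})$. -/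

import Mathlib

open scoped Manifold ContDiff ComplexConjugate

noncomputable section

namespace Octagon

/-- The inward normal vectors of the eight edges of the octagon with vertices `(0,2)`, `(0,1)`, `(1,0)`,
`(2,0)`, `(3,1)`, `(3,2)`, `(2,3)`, `(1,3)`, in counterclockwise order (starting with `x = 0`). -/
def normal : Fin 8 → ℤ × ℤ :=
  ![(1, 0), (1, 1), (0, 1), (-1, 1), (-1, 0), (-1, -1), (0, -1), (1, -1)]

/-- The octagon is the set of all `x` with `0 ≤ ⟨normal k, x⟩ + offset k` for all `k`. -/
def offset : Fin 8 → ℤ := ![0, -1, 0, 2, 3, 5, 3, 2]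

/-- The weights of the `T⁶`-action on `ℂ⁸`. -/
def weight : Fin 6 → Fin 8 → ℤ :=
  ![![1, 0, 0, 0, 1, 0, 0, 0],
    ![0, 1, 0, 0, 1, 0, 1, 0],
    ![0, 0, 1, 0, 0, 0, 1, 0],
    ![0, 0, 0, 1, -1, 0, 1, 0],
    ![0, 0, 0, 0, 1, -1, 1, 0],
    ![0, 0, 0, 0, 1, 0, -1, 1]]

/-- The constants in the manifold equations. -/
def level : Fin 6 → ℤ := ![6, 10, 6, 4, 2, 4]

/-- The momentum map `ℒ : ℂ⁸ → ℝ⁶`; the coordinates `z₁, …, z₈` are `z 0, …, z 7`. -/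
def momentL (z : Fin 8 → ℂ) (j : Fin 6) : ℝ :=
  -(1 / 2) * ((∑ k, (weight j k : ℝ) * ‖z k‖ ^ 2) - level j)

/-- The six torus `T⁶`. -/
abbrev Torus6 : Type := Fin 6 → Circle

/-- The phase by which `t ∈ T⁶` rotates the `k`-th coordinate of `ℂ⁸`. -/
def phase (t : Torus6) (k : Fin 8) : Circle := ∏ j, t j ^ weight j k

/-- The level set `ℒ⁻¹(0) ⊆ ℂ⁸`. -/
abbrev LevelSet : Type := {z : Fin 8 → ℂ // momentL z = 0}

lemma phase_one : phase 1 = 1 := by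
  funext k; simp [phase]

lemma phase_mul (s t : Torus6) : phase (s * t) = phase s * phase t := by
  funext k; simp [phase, mul_zpow, Finset.prod_mul_distrib]

lemma norm_phase_mul (t : Torus6) (k : Fin 8) (x : ℂ) : ‖(phase t k : ℂ) * x‖ = ‖x‖ := by
  rw [norm_mul, Circle.norm_coe, one_mul]

/-- The action of `T⁶` on `ℒ⁻¹(0)` generated by `ℒ`: the flow of the Hamiltonian vector field of the `j`-th
component of `ℒ` at time `θ` is `z ↦ (exp (i θ weight j k) z k)ₖ`. -/
instance : MulAction Torus6 LevelSet where
  smul t z := ⟨fun k => (phase t k : ℂ) * z.1 k, by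
    have h := z.2
    funext j
    have hj := congrFun h j
    simpa only [momentL, norm_phase_mul] using hj⟩
  one_smul z := Subtype.ext (funext fun k => by
    change ((phase 1 k : Circle) : ℂ) * z.1 k = z.1 k
    simp [phase_one])
  mul_smul s t z := Subtype.ext (funext fun k => by
    change ((phase (s * t) k : Circle) : ℂ) * z.1 k = (phase s k : ℂ) * ((phase t k : ℂ) * z.1 k)
    simp [phase_mul, mul_assoc])

lemma smul_val (t : Torus6) (z : LevelSet) (k : Fin 8) : (t • z).1 k = (phase t k : ℂ) * z.1 k := rfl

instance : ContinuousConstSMul Torus6 LevelSet where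
  continuous_const_smul t := by
    refine Continuous.subtype_mk (continuous_pi fun k => ?_) _
    exact continuous_const.mul ((continuous_apply k).comp continuous_subtype_val)

/-- The symplectic quotient `M = ℒ⁻¹(0) / T⁶`, as a topological space. -/
def M : Type := MulAction.orbitRel.Quotient Torus6 LevelSet

instance : TopologicalSpace M :=
  inferInstanceAs (TopologicalSpace (Quotient (MulAction.orbitRel Torus6 LevelSet)))

/-- The quotient map `z ↦ [z]`. -/
def toM (z : LevelSet) : M := Quotient.mk (MulAction.orbitRel Torus6 LevelSet) z

lemma toM_surjective : Function.Surjective toM := Quotient.mk_surjective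

lemma continuous_toM : Continuous toM := continuous_quotient_mk'

lemma isOpenMap_toM : IsOpenMap toM := isOpenMap_quotient_mk'_mul

lemma isQuotientMap_toM : Topology.IsQuotientMap toM := isQuotientMap_quotient_mk'

lemma toM_eq {z w : LevelSet} (t : Torus6) (h : ∀ k, (phase t k : ℂ) * z.1 k = w.1 k) :
    toM z = toM w :=
  (Quotient.sound (s := MulAction.orbitRel Torus6 LevelSet)
    (show w ∈ MulAction.orbit Torus6 z from ⟨t, Subtype.ext (funext h)⟩)).symm

/-- A torus invariant function on `ℒ⁻¹(0)` descends to `M`. -/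
def descend {α : Type} (f : (Fin 8 → ℂ) → α)
    (hf : ∀ (t : Torus6) (z : Fin 8 → ℂ), f (fun k => (phase t k : ℂ) * z k) = f z) : M → α :=
  Quotient.lift (fun z : LevelSet => f z.1) (by
    rintro _ w ⟨t, rfl⟩
    exact hf t w.1)

lemma descend_toM {α : Type} (f : (Fin 8 → ℂ) → α)
    (hf : ∀ (t : Torus6) (z : Fin 8 → ℂ), f (fun k => (phase t k : ℂ) * z k) = f z) (z : LevelSet) :
    descend f hf (toM z) = f z.1 := rfl

/-- Coefficients `a`, `b` with `normal k = a • normal ν + b • normal (ν + 1)`. -/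
def coefA (ν k : Fin 8) : ℤ :=
  (normal k).1 * (normal (ν + 1)).2 - (normal k).2 * (normal (ν + 1)).1

def coefB (ν k : Fin 8) : ℤ := (normal ν).1 * (normal k).2 - (normal ν).2 * (normal k).1

def coefD (ν k : Fin 8) : ℤ :=
  2 * (offset k - coefA ν k * offset ν - coefB ν k * offset (ν + 1))

lemma coef_self : ∀ ν : Fin 8, coefA ν ν = 1 ∧ coefB ν ν = 0 ∧ coefD ν ν = 0 ∧
    coefA ν (ν + 1) = 0 ∧ coefB ν (ν + 1) = 1 ∧ coefD ν (ν + 1) = 0 ∧ ν ≠ ν + 1 := by decide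

lemma sum_weight_coef : ∀ (j : Fin 6) (ν : Fin 8), (∑ k, weight j k * coefA ν k = 0) ∧
    (∑ k, weight j k * coefB ν k = 0) ∧ (∑ k, weight j k * coefD ν k = level j) := by decide

lemma normal_eq : ∀ ν k : Fin 8, normal k = coefA ν k • normal ν + coefB ν k • normal (ν + 1) := by
  decide

/-- The manifold equations, solved for `|z k|²` in terms of `|z ν|²` and `|z (ν + 1)|²`. -/
lemma sq_norm_of_mem (ν k : Fin 8) {z : Fin 8 → ℂ} (hz : momentL z = 0) :
    ‖z k‖ ^ 2 = coefA ν k * ‖z ν‖ ^ 2 + coefB ν k * ‖z (ν + 1)‖ ^ 2 + coefD ν k := by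
  have h0 := congrFun hz 0
  have h1 := congrFun hz 1
  have h2 := congrFun hz 2
  have h3 := congrFun hz 3
  have h4 := congrFun hz 4
  have h5 := congrFun hz 5
  simp [momentL, weight, level, Fin.sum_univ_eight] at h0 h1 h2 h3 h4 h5
  fin_cases ν <;> fin_cases k <;> simp [coefA, coefB, coefD, normal, offset] <;> linarith

lemma mem_of_sq_norm (ν : Fin 8) {z : Fin 8 → ℂ} {x y : ℝ}
    (h : ∀ k, ‖z k‖ ^ 2 = coefA ν k * x + coefB ν k * y + coefD ν k) : momentL z = 0 := by
  funext j
  obtain ⟨ha, hb, hd⟩ := sum_weight_coef j ν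
  have ha' : (∑ k, (weight j k : ℝ) * coefA ν k) = 0 := by exact_mod_cast ha
  have hb' : (∑ k, (weight j k : ℝ) * coefB ν k) = 0 := by exact_mod_cast hb
  have hd' : (∑ k, (weight j k : ℝ) * coefD ν k) = level j := by exact_mod_cast hd
  have : (∑ k, (weight j k : ℝ) * ‖z k‖ ^ 2) = level j := by
    have : ∀ k, (weight j k : ℝ) * ‖z k‖ ^ 2 = (weight j k : ℝ) * coefA ν k * x +
        (weight j k : ℝ) * coefB ν k * y + (weight j k : ℝ) * coefD ν k := by
      intro k; rw [h]; ring
    simp only [this, Finset.sum_add_distrib, ← Finset.sum_mul, ha', hb', hd']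
    ring
  simp [momentL, this]

lemma exists_index {z : Fin 8 → ℂ} (hz : momentL z = 0) :
    ∃ ν : Fin 8, ∀ k, k ≠ ν → k ≠ ν + 1 → z k ≠ 0 := by
  have key : ∀ k l : Fin 8, l ≠ k → l ≠ k + 1 → l + 1 ≠ k → z k = 0 → z l ≠ 0 := by
    intro k l h1 h2 h3 hk hl
    have hm := fun m => sq_norm_of_mem 0 m hz
    have hp : ∀ m, 0 ≤ ‖z m‖ ^ 2 := fun m => sq_nonneg _
    have e0 : ‖z k‖ ^ 2 = 0 := by simp [hk]
    have e1 : ‖z l‖ ^ 2 = 0 := by simp [hl]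
    have m1 := hm 2
    have m2 := hm 3
    have m3 := hm 4
    have m4 := hm 5
    have m5 := hm 6
    have m6 := hm 7
    simp [coefA, coefB, coefD, normal, offset] at m1 m2 m3 m4 m5 m6
    have p0 := hp 0
    have p1 := hp 1
    have p2 := hp 2
    have p3 := hp 3
    have p4 := hp 4
    have p5 := hp 5
    have p6 := hp 6
    have p7 := hp 7
    clear hm hp hk hl hz
    fin_cases k <;> fin_cases l <;> first | (exact absurd rfl h1) | (exact absurd rfl h2) | (exact absurd rfl h3) | (clear h1 h2 h3; simp only [Fin.mk_zero, Fin.mk_one, Fin.reduceFinMk, Fin.isValue] at *; linarith)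
  by_cases h : ∃ k, z k = 0
  · obtain ⟨k, hk⟩ := h
    by_cases h1 : z (k + 1) = 0
    · refine ⟨k, fun l hl hl' => ?_⟩
      by_cases h3 : l + 1 = k
      · have hne : ∀ m : Fin 8, m ≠ m + 1 + 1 ∧ m ≠ m + 1 + 1 + 1 ∧ m + 1 ≠ m + 1 + 1 := by decide
        subst h3
        exact key _ l (hne l).1 (hne l).2.1 (hne l).2.2 h1
      · exact key k l hl hl' h3 hk
    · refine ⟨k - 1, fun l hl hl' => ?_⟩
      by_cases h3 : l = k + 1
      · rwa [h3]
      · refine key k l ?_ h3 ?_ hk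
        · rintro rfl; simp at hl'
        · rintro rfl; simp at hl
  · push Not at h
    exact ⟨0, fun k _ _ => h k⟩

lemma coe_circle_prod (f : Fin 8 → Circle) : ((∏ k, f k : Circle) : ℂ) = ∏ k, (f k : ℂ) :=
  map_prod Circle.coeHom f Finset.univ

lemma prod_coefA {G : Type} [CommGroup G] (ν : Fin 8) (f : Fin 8 → G) :
    ∏ k, f k ^ coefA ν k =
      f ν * ∏ k, if k = ν ∨ k = ν + 1 then 1 else f k ^ coefA ν k := by
  obtain ⟨h1, -, -, h2, -, -, h3⟩ := coef_self ν
  have : f ν = ∏ k, if k = ν then f k else 1 := by simp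
  rw [this, ← Finset.prod_mul_distrib]
  refine Finset.prod_congr rfl fun k _ => ?_
  by_cases e1 : k = ν
  · subst e1; simp [h1]
  · by_cases e2 : k = ν + 1
    · subst e2; simp [h2]
    · simp [e1, e2]

lemma prod_coefB {G : Type} [CommGroup G] (ν : Fin 8) (f : Fin 8 → G) :
    ∏ k, f k ^ coefB ν k =
      f (ν + 1) * ∏ k, if k = ν ∨ k = ν + 1 then 1 else f k ^ coefB ν k := by
  obtain ⟨-, h1, -, -, h2, -, h3⟩ := coef_self ν
  have : f (ν + 1) = ∏ k, if k = ν + 1 then f k else 1 := by simp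
  rw [this, ← Finset.prod_mul_distrib]
  refine Finset.prod_congr rfl fun k _ => ?_
  by_cases e2 : k = ν + 1
  · subst e2; simp [h2]
  · by_cases e1 : k = ν
    · subst e1; simp [h1]
    · simp [e1, e2]

lemma prod_phase_zpow (t : Torus6) (c : Fin 8 → ℤ) (hc : ∀ j, ∑ k, weight j k * c k = 0) :
    ∏ k, phase t k ^ c k = 1 := by
  simp only [phase, ← Finset.prod_zpow, ← zpow_mul]
  rw [Finset.prod_comm]
  refine Finset.prod_eq_one fun j _ => ?_
  have h8 : ∀ e : Fin 8 → ℤ, ∏ k, t j ^ e k = t j ^ ∑ k, e k := by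
    intro e
    simp only [Fin.prod_univ_eight, Fin.sum_univ_eight, zpow_add]
  rw [h8, hc, zpow_zero]

lemma prod_phase_coef (t : Torus6) (ν : Fin 8) :
    ∏ k, phase t k ^ coefA ν k = 1 ∧ ∏ k, phase t k ^ coefB ν k = 1 := by
  exact ⟨prod_phase_zpow t _ fun j => (sum_weight_coef j ν).1,
    prod_phase_zpow t _ fun j => (sum_weight_coef j ν).2.1⟩

lemma exists_torus (l : Fin 8 → Circle) (ν : Fin 8) (ha : ∏ k, l k ^ coefA ν k = 1)
    (hb : ∏ k, l k ^ coefB ν k = 1) : ∃ t : Torus6, phase t = l := by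
  have h1 : ∏ k, l k ^ (normal k).1 = 1 := by
    have : ∀ k, l k ^ (normal k).1 =
        (l k ^ coefA ν k) ^ (normal ν).1 * (l k ^ coefB ν k) ^ (normal (ν + 1)).1 := by
      intro k
      have := congrArg Prod.fst (normal_eq ν k)
      simp at this
      rw [this, zpow_add, zpow_mul, zpow_mul]
    simp only [this, Finset.prod_mul_distrib, Finset.prod_zpow, ha, hb, one_zpow, mul_one]
  have h2 : ∏ k, l k ^ (normal k).2 = 1 := by
    have : ∀ k, l k ^ (normal k).2 =
        (l k ^ coefA ν k) ^ (normal ν).2 * (l k ^ coefB ν k) ^ (normal (ν + 1)).2 := by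
      intro k
      have := congrArg Prod.snd (normal_eq ν k)
      simp at this
      rw [this, zpow_add, zpow_mul, zpow_mul]
    simp only [this, Finset.prod_mul_distrib, Finset.prod_zpow, ha, hb, one_zpow, mul_one]
  simp [Fin.prod_univ_eight, normal] at h1 h2
  refine ⟨![l 0, l 1, l 2, l 3, (l 5)⁻¹, l 7], ?_⟩
  funext k
  fin_cases k <;> simp [phase, Fin.prod_univ_six, weight]
  · rw [← mul_inv_eq_one, ← h1]
    simp only [mul_comm, mul_left_comm, mul_assoc]
  · rw [← mul_inv_eq_one, ← h2]
    simp only [mul_comm, mul_left_comm, mul_assoc]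

/-- The chart map on representatives: use the torus action to make the coordinates `z k` with
`k ≠ ν, ν + 1` positive, and read off the coordinates `z ν` and `z (ν + 1)`. -/
def chartUp (ν : Fin 8) (z : Fin 8 → ℂ) : ℂ × ℂ :=
  (z ν * ∏ k, if k = ν ∨ k = ν + 1 then 1 else (z k / (‖z k‖ : ℂ)) ^ coefA ν k,
   z (ν + 1) * ∏ k, if k = ν ∨ k = ν + 1 then 1 else (z k / (‖z k‖ : ℂ)) ^ coefB ν k)

/-- The expressions under the square roots in the chart `φ_ν`. -/
def radicand (ν k : Fin 8) (w : ℂ × ℂ) : ℝ :=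
  coefA ν k * ‖w.1‖ ^ 2 + coefB ν k * ‖w.2‖ ^ 2 + coefD ν k

/-- The domain of `φ_ν`: all expressions under the square roots are positive. -/
def chartTarget (ν : Fin 8) : Set (ℂ × ℂ) :=
  {w | ∀ k, k ≠ ν → k ≠ ν + 1 → 0 < radicand ν k w}

/-- The representative of `φ_ν(w)` in `ℒ⁻¹(0)` whose coordinates with index `k ≠ ν, ν + 1` are positive. -/
def chartSection (ν : Fin 8) (w : ℂ × ℂ) (k : Fin 8) : ℂ :=
  if k = ν then w.1 else if k = ν + 1 then w.2 else (Real.sqrt (radicand ν k w) : ℂ)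

lemma sq_norm_chartSection {ν : Fin 8} {w : ℂ × ℂ} (hw : w ∈ chartTarget ν) (k : Fin 8) :
    ‖chartSection ν w k‖ ^ 2 = radicand ν k w := by
  obtain ⟨h1, h2, h3, h4, h5, h6, h7⟩ := coef_self ν
  by_cases e1 : k = ν
  · subst e1; simp [chartSection, radicand, h1, h2, h3]
  · by_cases e2 : k = ν + 1
    · subst e2; simp [chartSection, radicand, h4, h5, h6, h7.symm]
    · have := hw k e1 e2
      simp [chartSection, e1, e2, Real.sq_sqrt this.le]

lemma chartSection_mem {ν : Fin 8} {w : ℂ × ℂ} (hw : w ∈ chartTarget ν) :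
    momentL (chartSection ν w) = 0 :=
  mem_of_sq_norm ν (x := ‖w.1‖ ^ 2) (y := ‖w.2‖ ^ 2) fun k => sq_norm_chartSection hw k

lemma norm_div_norm {x : ℂ} (hx : x ≠ 0) : ‖x / (‖x‖ : ℂ)‖ = 1 := by
  simp [hx]

lemma norm_unitProd {ν : Fin 8} {z : Fin 8 → ℂ} (hz : ∀ k, k ≠ ν → k ≠ ν + 1 → z k ≠ 0)
    (c : Fin 8 → ℤ) :
    ‖∏ k, if k = ν ∨ k = ν + 1 then (1 : ℂ) else (z k / (‖z k‖ : ℂ)) ^ c k‖ = 1 := by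
  rw [norm_prod]
  refine Finset.prod_eq_one fun k _ => ?_
  split_ifs with h
  · simp
  · push Not at h
    rw [norm_zpow, norm_div_norm (hz k h.1 h.2), one_zpow]

lemma chartUp_smul (ν : Fin 8) (t : Torus6) (z : Fin 8 → ℂ) :
    chartUp ν (fun k => (phase t k : ℂ) * z k) = chartUp ν z := by
  obtain ⟨ha, hb⟩ := prod_phase_coef t ν
  rw [prod_coefA] at ha
  rw [prod_coefB] at hb
  have key : ∀ c : Fin 8 → ℤ, (∏ k, if k = ν ∨ k = ν + 1 then (1 : ℂ) else
      ((phase t k : ℂ) * z k / (‖(phase t k : ℂ) * z k‖ : ℂ)) ^ c k) =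
      ((∏ k, if k = ν ∨ k = ν + 1 then 1 else phase t k ^ c k : Circle) : ℂ) *
      ∏ k, if k = ν ∨ k = ν + 1 then (1 : ℂ) else (z k / (‖z k‖ : ℂ)) ^ c k := by
    intro c
    have : ((∏ k, if k = ν ∨ k = ν + 1 then 1 else phase t k ^ c k : Circle) : ℂ) =
        ∏ k, if k = ν ∨ k = ν + 1 then (1 : ℂ) else (phase t k : ℂ) ^ c k := by
      rw [coe_circle_prod]
      refine Finset.prod_congr rfl fun k _ => ?_
      split_ifs <;> simp
    rw [this, ← Finset.prod_mul_distrib]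
    refine Finset.prod_congr rfl fun k _ => ?_
    split_ifs
    · simp
    · rw [norm_phase_mul, mul_div_assoc, mul_zpow]
  have ha' := congrArg (fun c : Circle => (c : ℂ)) ha
  have hb' := congrArg (fun c : Circle => (c : ℂ)) hb
  simp only [Circle.coe_mul, Circle.coe_one] at ha' hb'
  simp only [chartUp, key]
  refine Prod.ext ?_ ?_
  · simp only
    linear_combination (z ν * ∏ k, if k = ν ∨ k = ν + 1 then (1 : ℂ) else
      (z k / (‖z k‖ : ℂ)) ^ coefA ν k) * ha'
  · simp only
    linear_combination (z (ν + 1) * ∏ k, if k = ν ∨ k = ν + 1 then (1 : ℂ) else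
      (z k / (‖z k‖ : ℂ)) ^ coefB ν k) * hb'

lemma chartUp_chartSection {ν : Fin 8} {w : ℂ × ℂ} (hw : w ∈ chartTarget ν) :
    chartUp ν (chartSection ν w) = w := by
  have h3 := (coef_self ν).2.2.2.2.2.2
  have key : ∀ c : Fin 8 → ℤ, (∏ k, if k = ν ∨ k = ν + 1 then (1 : ℂ) else
      (chartSection ν w k / (‖chartSection ν w k‖ : ℂ)) ^ c k) = 1 := by
    intro c
    refine Finset.prod_eq_one fun k _ => ?_
    split_ifs with h
    · rfl
    · push Not at h
      have hp := Real.sqrt_pos.2 (hw k h.1 h.2)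
      have : chartSection ν w k = (Real.sqrt (radicand ν k w) : ℂ) := by
        simp [chartSection, h.1, h.2]
      rw [this, Complex.norm_real, Real.norm_of_nonneg hp.le, div_self, one_zpow]
      exact_mod_cast hp.ne'
  simp only [chartUp, key, mul_one]
  simp [chartSection, h3.symm]

lemma radicand_chartUp {ν : Fin 8} {z : Fin 8 → ℂ} (hz : momentL z = 0)
    (h : ∀ k, k ≠ ν → k ≠ ν + 1 → z k ≠ 0) (k : Fin 8) :
    radicand ν k (chartUp ν z) = ‖z k‖ ^ 2 := by
  rw [sq_norm_of_mem ν k hz]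
  simp only [radicand, chartUp, norm_mul, norm_unitProd h, mul_one]

lemma chartUp_mem {ν : Fin 8} {z : Fin 8 → ℂ} (hz : momentL z = 0)
    (h : ∀ k, k ≠ ν → k ≠ ν + 1 → z k ≠ 0) : chartUp ν z ∈ chartTarget ν := by
  intro k h1 h2
  rw [radicand_chartUp hz h]
  have := norm_pos_iff.2 (h k h1 h2)
  positivity

lemma toM_chartSection {ν : Fin 8} {z : LevelSet} (h : ∀ k, k ≠ ν → k ≠ ν + 1 → z.1 k ≠ 0) :
    toM z = toM ⟨chartSection ν (chartUp ν z.1), chartSection_mem (chartUp_mem z.2 h)⟩ := by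
  have h3 := (coef_self ν).2.2.2.2.2.2
  let u : Fin 8 → Circle := fun k => if hk : z.1 k = 0 then 1 else
    ⟨z.1 k / (‖z.1 k‖ : ℂ), mem_sphere_zero_iff_norm.2 (norm_div_norm hk)⟩
  have hu : ∀ k, z.1 k ≠ 0 → (u k : ℂ) = z.1 k / (‖z.1 k‖ : ℂ) := by
    intro k hk; simp [u, hk]
  let A : Circle := ∏ k, if k = ν ∨ k = ν + 1 then 1 else u k ^ coefA ν k
  let B : Circle := ∏ k, if k = ν ∨ k = ν + 1 then 1 else u k ^ coefB ν k
  have hcoe : ∀ c : Fin 8 → ℤ,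
      ((∏ k, if k = ν ∨ k = ν + 1 then 1 else u k ^ c k : Circle) : ℂ) =
      ∏ k, if k = ν ∨ k = ν + 1 then (1 : ℂ) else (z.1 k / (‖z.1 k‖ : ℂ)) ^ c k := by
    intro c
    rw [coe_circle_prod]
    refine Finset.prod_congr rfl fun k _ => ?_
    split_ifs with hk
    · simp
    · push Not at hk
      simp [hu k (h k hk.1 hk.2)]
  let l : Fin 8 → Circle := fun k => if k = ν then A else if k = ν + 1 then B else (u k)⁻¹
  have hrest : ∀ c : Fin 8 → ℤ, (∏ k, if k = ν ∨ k = ν + 1 then 1 else l k ^ c k) =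
      (∏ k, if k = ν ∨ k = ν + 1 then 1 else u k ^ c k)⁻¹ := by
    intro c
    rw [← Finset.prod_inv_distrib]
    refine Finset.prod_congr rfl fun k _ => ?_
    split_ifs with hk
    · simp
    · push Not at hk
      simp [l, hk.1, hk.2]
  obtain ⟨t, ht⟩ := exists_torus l ν
    (by rw [prod_coefA, hrest]; simp [l, A])
    (by rw [prod_coefB, hrest]; simp [l, B, h3.symm])
  refine toM_eq t fun k => ?_
  rw [ht]
  by_cases e1 : k = ν
  · subst e1
    simp [l, chartSection, chartUp, A, hcoe, mul_comm]
  · by_cases e2 : k = ν + 1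
    · subst e2
      simp [l, chartSection, chartUp, B, hcoe, mul_comm, h3.symm]
    · have hk := h k e1 e2
      simp only [l, e1, e2, if_false, chartSection, radicand_chartUp z.2 h,
        Real.sqrt_sq (norm_nonneg _), Circle.coe_inv, hu k hk]
      field_simp

lemma isOpen_chartTarget (ν : Fin 8) : IsOpen (chartTarget ν) := by
  have : chartTarget ν = ⋂ k, ⋂ (_ : k ≠ ν), ⋂ (_ : k ≠ ν + 1), {w | 0 < radicand ν k w} := by
    ext w; simp [chartTarget]
  rw [this]
  refine isOpen_iInter_of_finite fun k => isOpen_iInter_of_finite fun _ =>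
    isOpen_iInter_of_finite fun _ => isOpen_lt continuous_const ?_
  unfold radicand
  fun_prop

lemma contDiffAt_chartSection {ν : Fin 8} {w : ℂ × ℂ} (hw : w ∈ chartTarget ν) :
    ContDiffAt ℝ ∞ (chartSection ν) w := by
  refine contDiffAt_pi.2 fun k => ?_
  unfold chartSection
  by_cases e1 : k = ν
  · simpa only [e1, if_true] using contDiffAt_fst
  · by_cases e2 : k = ν + 1
    · simpa only [e1, e2, if_false, if_true, (coef_self ν).2.2.2.2.2.2.symm] using contDiffAt_snd
    · simp only [e1, e2, if_false]
      refine Complex.ofRealCLM.contDiff.contDiffAt.comp w (ContDiffAt.sqrt ?_ (hw k e1 e2).ne')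
      unfold radicand
      have h1 : ContDiff ℝ ∞ fun w : ℂ × ℂ => ‖w.1‖ ^ 2 := contDiff_fst.norm_sq ℝ
      have h2 : ContDiff ℝ ∞ fun w : ℂ × ℂ => ‖w.2‖ ^ 2 := contDiff_snd.norm_sq ℝ
      exact (((contDiff_const.mul h1).add (contDiff_const.mul h2)).add contDiff_const).contDiffAt

lemma contDiffAt_unitProd {ν : Fin 8} {z : Fin 8 → ℂ} (h : ∀ k, k ≠ ν → k ≠ ν + 1 → z k ≠ 0)
    (c : Fin 8 → ℤ) : ContDiffAt ℝ ∞ (fun z : Fin 8 → ℂ =>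
      ∏ k, if k = ν ∨ k = ν + 1 then (1 : ℂ) else (z k / (‖z k‖ : ℂ)) ^ c k) z := by
  refine contDiffAt_prod fun k _ => ?_
  by_cases hk : k = ν ∨ k = ν + 1
  · simp only [hk, if_true]
    exact contDiffAt_const
  · simp only [hk, if_false]
    push Not at hk
    have hz := h k hk.1 hk.2
    have h1 : ContDiffAt ℝ ∞ (fun z : Fin 8 → ℂ => z k) z := (contDiff_apply ℝ ℂ k).contDiffAt
    have h2 : ContDiffAt ℝ ∞ (fun z : Fin 8 → ℂ => (‖z k‖ : ℂ)) z :=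
      Complex.ofRealCLM.contDiff.contDiffAt.comp z (h1.norm ℝ hz)
    have h3 : ContDiffAt ℝ ∞ (fun z : Fin 8 → ℂ => z k / (‖z k‖ : ℂ)) z := by
      simp only [div_eq_mul_inv]
      exact h1.mul (h2.inv (by simpa using hz))
    rcases c k with n | n
    · simpa using h3.pow n
    · simp only [zpow_negSucc]
      exact (h3.pow (n + 1)).inv (pow_ne_zero _ (div_ne_zero hz (by simpa using hz)))

lemma contDiffAt_chartUp {ν : Fin 8} {z : Fin 8 → ℂ} (h : ∀ k, k ≠ ν → k ≠ ν + 1 → z k ≠ 0) :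
    ContDiffAt ℝ ∞ (chartUp ν) z :=
  ((contDiff_apply ℝ ℂ ν).contDiffAt.mul (contDiffAt_unitProd h _)).prodMk
    ((contDiff_apply ℝ ℂ (ν + 1)).contDiffAt.mul (contDiffAt_unitProd h _))

/-- The set `U_ν ⊆ M` of all `[z]` with `z k ≠ 0` for all `k ≠ ν, ν + 1`. -/
def chartSource (ν : Fin 8) : Set M :=
  {p | descend (fun z => ∀ k, k ≠ ν → k ≠ ν + 1 → z k ≠ 0) (by intro t z; simp) p}

/-- The function underlying the chart `U_ν → ℂ²`. -/
def chartFun (ν : Fin 8) : M → ℂ × ℂ := descend (chartUp ν) (chartUp_smul ν)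

lemma toM_mem_chartSource {ν : Fin 8} {z : LevelSet} :
    toM z ∈ chartSource ν ↔ ∀ k, k ≠ ν → k ≠ ν + 1 → z.1 k ≠ 0 := Iff.rfl

lemma chartFun_toM (ν : Fin 8) (z : LevelSet) : chartFun ν (toM z) = chartUp ν z.1 := rfl

lemma isOpen_chartSource (ν : Fin 8) : IsOpen (chartSource ν) := by
  rw [← isQuotientMap_toM.isOpen_preimage]
  have : toM ⁻¹' chartSource ν = ⋂ k, ⋂ (_ : k ≠ ν), ⋂ (_ : k ≠ ν + 1), {z | z.1 k ≠ 0} := by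
    ext w; simp [toM_mem_chartSource]
  rw [this]
  refine isOpen_iInter_of_finite fun k => isOpen_iInter_of_finite fun _ =>
    isOpen_iInter_of_finite fun _ => isOpen_ne_fun ?_ continuous_const
  exact (continuous_apply k).comp continuous_subtype_val

lemma chartSection_ne_zero {ν : Fin 8} {w : ℂ × ℂ} (hw : w ∈ chartTarget ν) (k : Fin 8)
    (h1 : k ≠ ν) (h2 : k ≠ ν + 1) : chartSection ν w k ≠ 0 := by
  have h := sq_norm_chartSection hw k
  intro h0
  rw [h0] at h
  have := hw k h1 h2
  simp at h
  linarith

lemma zero_mem_chartTarget : (0 : ℂ × ℂ) ∈ chartTarget 0 := by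
  have : ∀ k : Fin 8, k ≠ 0 → k ≠ 0 + 1 → 0 < coefD 0 k := by decide
  intro k h1 h2
  have := this k h1 h2
  simpa [radicand] using this

open Classical in
/-- The inverse of the chart, `φ_ν : w ↦ [chartSection ν w]`; its value outside of `chartTarget ν` is
irrelevant. -/
def chartInv (ν : Fin 8) (w : ℂ × ℂ) : M :=
  if hw : w ∈ chartTarget ν then toM ⟨chartSection ν w, chartSection_mem hw⟩
  else toM ⟨chartSection 0 0, chartSection_mem zero_mem_chartTarget⟩

lemma chartInv_of_mem {ν : Fin 8} {w : ℂ × ℂ} (hw : w ∈ chartTarget ν) :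
    chartInv ν w = toM ⟨chartSection ν w, chartSection_mem hw⟩ := dif_pos hw

/-- The chart of `M` with domain `U_ν` and inverse `φ_ν`. -/
def chart (ν : Fin 8) : OpenPartialHomeomorph M (ℂ × ℂ) where
  toFun := chartFun ν
  invFun := chartInv ν
  source := chartSource ν
  target := chartTarget ν
  map_source' p hp := by
    obtain ⟨z, rfl⟩ := toM_surjective p
    exact chartUp_mem z.2 hp
  map_target' w hw := by
    rw [chartInv_of_mem hw, toM_mem_chartSource]
    exact chartSection_ne_zero hw
  left_inv' p hp := by
    obtain ⟨z, rfl⟩ := toM_surjective p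
    rw [chartFun_toM, chartInv_of_mem (chartUp_mem z.2 hp), ← toM_chartSection hp]
  right_inv' w hw := by
    rw [chartInv_of_mem hw, chartFun_toM, chartUp_chartSection hw]
  open_source := isOpen_chartSource ν
  open_target := isOpen_chartTarget ν
  continuousOn_toFun := by
    rw [isQuotientMap_toM.continuousOn_isOpen_iff (isOpen_chartSource ν)]
    intro z hz
    exact ((contDiffAt_chartUp hz).continuousAt.comp
      (continuous_subtype_val.continuousAt)).continuousWithinAt
  continuousOn_invFun := by
    rw [continuousOn_iff_continuous_domRestrict]
    have : (chartTarget ν).domRestrict (chartInv ν) = fun w : chartTarget ν =>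
        toM ⟨chartSection ν w.1, chartSection_mem w.2⟩ := by
      funext w
      exact chartInv_of_mem w.2
    rw [this]
    refine continuous_toM.comp (Continuous.subtype_mk ?_ _)
    have h : ContinuousOn (chartSection ν) (chartTarget ν) := fun w hw =>
      (contDiffAt_chartSection hw).continuousAt.continuousWithinAt
    exact h.domRestrict

lemma exists_chartIndex (p : M) : ∃ ν, p ∈ (chart ν).source := by
  obtain ⟨z, rfl⟩ := toM_surjective p
  exact exists_index z.2

/-- The index of the preferred chart at a point. -/
def chartIndex (p : M) : Fin 8 := (exists_chartIndex p).choose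

lemma mem_chart_source_chartIndex (p : M) : p ∈ (chart (chartIndex p)).source :=
  (exists_chartIndex p).choose_spec

instance : ChartedSpace (ℂ × ℂ) M where
  atlas := Set.range chart
  chartAt p := chart (chartIndex p)
  mem_chart_source := mem_chart_source_chartIndex
  chart_mem_atlas _ := Set.mem_range_self _

instance : IsManifold 𝓘(ℝ, ℂ × ℂ) ∞ M := by
  refine isManifold_of_contDiffOn _ _ _ ?_
  rintro _ _ ⟨ν, rfl⟩ ⟨μ, rfl⟩ w hw
  simp only [modelWithCornersSelf_coe, modelWithCornersSelf_coe_symm, Set.range_id, Set.preimage_id_eq,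
    id_eq, Set.inter_univ, Function.comp_id, Function.id_comp] at hw ⊢
  have hw1 : w ∈ chartTarget ν := ((chart ν).symm.trans_source (chart μ) ▸ hw).1
  have hw2 : chartInv ν w ∈ chartSource μ := ((chart ν).symm.trans_source (chart μ) ▸ hw).2
  rw [chartInv_of_mem hw1, toM_mem_chartSource] at hw2
  have h : ContDiffAt ℝ ∞ (chartUp μ ∘ chartSection ν) w :=
    (contDiffAt_chartUp hw2).comp w (contDiffAt_chartSection hw1)
  refine (h.congr_of_eventuallyEq ?_).contDiffWithinAt
  filter_upwards [(isOpen_chartTarget ν).mem_nhds hw1] with y hy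
  change chartFun μ (chartInv ν y) = _
  rw [chartInv_of_mem hy]
  rfl

/-- A nondegenerate two-form on a manifold modelled on `E`, as a family of bilinear forms on the tangent
spaces. -/
structure NondegTwoForm (E : Type) [NormedAddCommGroup E] [NormedSpace ℝ E]
    (X : Type) [TopologicalSpace X] [ChartedSpace E X] where
  toFun : ∀ p : X, LinearMap.BilinForm ℝ (TangentSpace 𝓘(ℝ, E) p)
  isAlt : ∀ p, (toFun p).IsAlt
  nondegenerate : ∀ p, (toFun p).Nondegenerate

section Poisson

variable {E : Type} [NormedAddCommGroup E] [NormedSpace ℝ E] [FiniteDimensional ℝ E]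
  {X : Type} [TopologicalSpace X] [ChartedSpace E X]

instance (p : X) : FiniteDimensional ℝ (TangentSpace 𝓘(ℝ, E) p) :=
  inferInstanceAs (FiniteDimensional ℝ E)

/-- The Hamiltonian vector field `X^f` of `f`: the vector field with `Ω (X^f, ·) = df`. -/
def hamiltonianVectorField (Ω : NondegTwoForm E X) (f : X → ℝ) (p : X) : TangentSpace 𝓘(ℝ, E) p :=
  ((Ω.toFun p).toDual (Ω.nondegenerate p)).symm (mvfderiv 𝓘(ℝ, E) f p).toLinearMap

lemma hamiltonianVectorField_spec (Ω : NondegTwoForm E X) (f : X → ℝ) (p : X)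
    (v : TangentSpace 𝓘(ℝ, E) p) :
    Ω.toFun p (hamiltonianVectorField Ω f p) v = mvfderiv 𝓘(ℝ, E) f p v :=
  LinearMap.BilinForm.apply_toDual_symm_apply (B := Ω.toFun p) _ v

/-- The Poisson bracket `{g, h} = Ω (X^g, X^h)`. -/
def poissonBracket (Ω : NondegTwoForm E X) (g h : X → ℝ) (p : X) : ℝ :=
  Ω.toFun p (hamiltonianVectorField Ω g p) (hamiltonianVectorField Ω h p)

/-- Two functions Poisson commute if their Poisson bracket vanishes identically. -/
def PoissonCommute (Ω : NondegTwoForm E X) (g h : X → ℝ) : Prop :=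
  ∀ p, poissonBracket Ω g h p = 0

end Poisson

/-- The standard symplectic form `(i/2) ∑ₖ dzₖ ∧ dz̄ₖ = ∑ₖ dxₖ ∧ dyₖ` on `ℂⁿ`. -/
def stdForm (n : ℕ) : LinearMap.BilinForm ℝ (Fin n → ℂ) :=
  LinearMap.mk₂ ℝ (fun v w => ∑ k, ((v k).re * (w k).im - (v k).im * (w k).re))
    (by intro u v w
        rw [← Finset.sum_add_distrib]
        exact Finset.sum_congr rfl fun k _ => by simp only [Pi.add_apply, Complex.add_re, Complex.add_im]; ring)
    (by intro c v w
        rw [smul_eq_mul, Finset.mul_sum]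
        exact Finset.sum_congr rfl fun k _ => by simp; ring)
    (by intro u v w
        rw [← Finset.sum_add_distrib]
        exact Finset.sum_congr rfl fun k _ => by simp only [Pi.add_apply, Complex.add_re, Complex.add_im]; ring)
    (by intro c v w
        rw [smul_eq_mul, Finset.mul_sum]
        exact Finset.sum_congr rfl fun k _ => by simp; ring)

lemma stdForm_apply {n : ℕ} (v w : Fin n → ℂ) :
    stdForm n v w = ∑ k, ((v k).re * (w k).im - (v k).im * (w k).re) := rfl

lemma stdForm_eq {n : ℕ} (v w : Fin n → ℂ) : ((stdForm n v w : ℝ) : ℂ) =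
    Complex.I / 2 * ∑ k, (v k * conj (w k) - w k * conj (v k)) := by
  rw [stdForm_apply, Complex.ofReal_sum, Finset.mul_sum]
  refine Finset.sum_congr rfl fun k _ => ?_
  apply Complex.ext <;> simp <;> ring

lemma stdForm_isAlt (n : ℕ) : (stdForm n).IsAlt := by
  intro v
  rw [stdForm_apply]
  exact Finset.sum_eq_zero fun k _ => by ring

lemma stdForm_nondegenerate (n : ℕ) : (stdForm n).Nondegenerate := by
  have key : ∀ v, (∀ w, stdForm n v w = 0) → v = 0 := by
    intro v hv
    funext k
    have h1 := hv (Pi.single k Complex.I)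
    have h2 := hv (Pi.single k 1)
    rw [stdForm_apply, Finset.sum_eq_single k (by intro b _ hb; simp [hb]) (by simp)] at h1 h2
    apply Complex.ext <;> simp_all
  refine ⟨key, fun v hv => key v fun w => ?_⟩
  rw [← neg_eq_zero, (stdForm_isAlt n).neg_eq]
  exact hv w

/-- The standard symplectic form on the manifold `ℂⁿ`. -/
def omegaSt (n : ℕ) : NondegTwoForm (Fin n → ℂ) (Fin n → ℂ) where
  toFun _ := stdForm n
  isAlt _ := stdForm_isAlt n
  nondegenerate _ := stdForm_nondegenerate n

/-- The local section `U_ν → ℒ⁻¹(0) ⊆ ℂ⁸` of the quotient map given by the chart with index `ν`. -/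
def localSection (ν : Fin 8) (p : M) : Fin 8 → ℂ := chartSection ν (chart ν p)

/-- The value at `p` of the reduced form on `M`: tangent vectors of `M` are lifted to `ℒ⁻¹(0)` by means of a
local section of the quotient map near `p`, and `ω_st` is applied to the lifts. -/
def reducedForm (p : M) : LinearMap.BilinForm ℝ (TangentSpace 𝓘(ℝ, ℂ × ℂ) p) :=
  (stdForm 8).compl₁₂
    (mvfderiv 𝓘(ℝ, ℂ × ℂ) (localSection (chartIndex p)) p).toLinearMap
    (mvfderiv 𝓘(ℝ, ℂ × ℂ) (localSection (chartIndex p)) p).toLinearMap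

lemma contMDiffAt_localSection {ν : Fin 8} {p : M} (hp : p ∈ (chart ν).source) :
    ContMDiffAt 𝓘(ℝ, ℂ × ℂ) 𝓘(ℝ, Fin 8 → ℂ) ∞ (localSection ν) p := by
  have h1 : ContMDiffAt 𝓘(ℝ, ℂ × ℂ) 𝓘(ℝ, ℂ × ℂ) ∞ (chart ν) p :=
    contMDiffAt_of_mem_maximalAtlas (IsManifold.subset_maximalAtlas (Set.mem_range_self ν)) hp
  exact (contDiffAt_chartSection ((chart ν).map_source hp)).contMDiffAt.comp p h1

/-- The derivative of the local section of the preferred chart, in this chart. -/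
lemma mvfderiv_localSection (p : M) :
    mvfderiv 𝓘(ℝ, ℂ × ℂ) (localSection (chartIndex p)) p =
      fderiv ℝ (chartSection (chartIndex p)) (chart (chartIndex p) p) := by
  have hp := mem_chart_source_chartIndex p
  have hd := (contMDiffAt_localSection hp).mdifferentiableAt (by simp)
  have : mvfderiv 𝓘(ℝ, ℂ × ℂ) (localSection (chartIndex p)) p =
      fderiv ℝ (localSection (chartIndex p) ∘ (chart (chartIndex p)).symm)
        (chart (chartIndex p) p) := by
    ext v
    simp only [mvfderiv, mfderiv, hd, writtenInExtChartAt]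
    simp [extChartAt, chartAt]
    rfl
  rw [this]
  refine Filter.EventuallyEq.fderiv_eq ?_
  filter_upwards [(chart (chartIndex p)).open_target.mem_nhds ((chart (chartIndex p)).map_source hp)]
    with y hy
  simp only [Function.comp, localSection]
  rw [(chart (chartIndex p)).right_inv hy]

lemma fderiv_chartSection {ν : Fin 8} {w : ℂ × ℂ} (hw : w ∈ chartTarget ν) (v : ℂ × ℂ) :
    fderiv ℝ (chartSection ν) w v ν = v.1 ∧ fderiv ℝ (chartSection ν) w v (ν + 1) = v.2 ∧
    ∀ k, k ≠ ν → k ≠ ν + 1 → (fderiv ℝ (chartSection ν) w v k).im = 0 := by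
  have hd : DifferentiableAt ℝ (chartSection ν) w :=
    (contDiffAt_chartSection hw).differentiableAt (by simp)
  have hk : ∀ k, fderiv ℝ (chartSection ν) w v k = fderiv ℝ (fun w => chartSection ν w k) w v := by
    intro k
    rw [fderiv_apply hd k]
    rfl
  refine ⟨?_, ?_, ?_⟩
  · rw [hk]
    simp only [chartSection, if_true]
    rw [fderiv_fst]; rfl
  · rw [hk]
    simp only [chartSection, if_true, (coef_self ν).2.2.2.2.2.2.symm, if_false]
    rw [fderiv_snd]; rfl
  · intro k h1 h2
    rw [hk]
    have h3 : DifferentiableAt ℝ (fun w => chartSection ν w k) w := differentiableAt_pi.1 hd k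
    have h4 := Complex.imCLM.hasFDerivAt.comp w h3.hasFDerivAt
    have h5 : (Complex.imCLM ∘ fun w => chartSection ν w k) = fun _ => (0 : ℝ) := by
      funext w; simp [chartSection, h1, h2]
    rw [h5] at h4
    have := congrArg (fun l => l v) (h4.unique (hasFDerivAt_const 0 w))
    simpa using this

/-- In the preferred chart, the reduced form is the standard symplectic form of `ℂ²`. -/
lemma reducedForm_apply (p : M) (v w : ℂ × ℂ) : reducedForm p v w =
    (v.1.re * w.1.im - v.1.im * w.1.re) + (v.2.re * w.2.im - v.2.im * w.2.re) := by
  have hp := (chart (chartIndex p)).map_source (mem_chart_source_chartIndex p)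
  have : reducedForm p v w = stdForm 8
      (fderiv ℝ (chartSection (chartIndex p)) (chart (chartIndex p) p) v)
      (fderiv ℝ (chartSection (chartIndex p)) (chart (chartIndex p) p) w) := by
    rw [← mvfderiv_localSection]; rfl
  rw [this, stdForm_apply]
  obtain ⟨a1, a2, a3⟩ := fderiv_chartSection hp v
  obtain ⟨b1, b2, b3⟩ := fderiv_chartSection hp w
  rw [Fintype.sum_eq_add (chartIndex p) (chartIndex p + 1) (coef_self _).2.2.2.2.2.2
    (fun k hk => by rw [a3 k hk.1 hk.2, b3 k hk.1 hk.2]; ring), a1, a2, b1, b2]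

lemma reducedForm_isAlt (p : M) : (reducedForm p).IsAlt := fun _ => stdForm_isAlt 8 _

lemma reducedForm_nondegenerate (p : M) : (reducedForm p).Nondegenerate := by
  have key : ∀ v : ℂ × ℂ, (∀ w : ℂ × ℂ, reducedForm p v w = 0) → v = 0 := by
    intro v hv
    have h1 := hv (1, 0)
    have h2 := hv (Complex.I, 0)
    have h3 := hv (0, 1)
    have h4 := hv (0, Complex.I)
    rw [reducedForm_apply] at h1 h2 h3 h4
    simp at h1 h2 h3 h4
    exact Prod.ext (Complex.ext h2 h1) (Complex.ext h4 h3)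
  refine ⟨key, fun v hv => key v fun w => ?_⟩
  exact neg_eq_zero.1 (((reducedForm_isAlt p).neg_eq v w).trans (hv w))

/-- The symplectic form `ω` of the symplectic quotient `M`. -/
def omega : NondegTwoForm (ℂ × ℂ) M where
  toFun := reducedForm
  isAlt := reducedForm_isAlt
  nondegenerate := reducedForm_nondegenerate

lemma hasDerivAt_unit {g : ℝ → ℂ} {g' : ℂ} {t : ℝ} (hg : HasDerivAt g g' t) (h0 : g t ≠ 0) :
    HasDerivAt (fun s => g s / (‖g s‖ : ℂ))
      (Complex.I * ((g' / g t).im : ℂ) * (g t / (‖g t‖ : ℂ))) t := by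
  have hn : (‖g t‖ : ℂ) ≠ 0 := by simpa using h0
  have hnr : ‖g t‖ ≠ 0 := by simpa using h0
  have h1 : HasDerivAt (fun s => ‖g s‖) ((g' / g t).re * ‖g t‖) t := by
    have h2 := hg.norm_sq
    have h3 := h2.sqrt (by positivity)
    simp only [Real.sqrt_sq (norm_nonneg _)] at h3
    convert h3 using 1
    have e : g' = g' / g t * g t := by field_simp
    have h4 : inner ℝ (g t) g' = (g' / g t).re * ‖g t‖ ^ 2 := by
      rw [Complex.inner]
      conv_lhs => rw [e]
      rw [mul_assoc, Complex.mul_conj, Complex.normSq_eq_norm_sq]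
      rw [Complex.re_mul_ofReal]
    rw [h4]
    field_simp
  have h5 := hg.div h1.ofReal_comp hn
  refine HasDerivAt.congr_deriv (f := fun s => g s / (‖g s‖ : ℂ)) h5 ?_
  have e : g' = g' / g t * g t := by field_simp
  have e2 := Complex.re_add_im (g' / g t)
  conv_lhs => enter [1, 1, 1]; rw [e]
  generalize g' / g t = q at *
  rw [← e2]
  simp
  field_simp
  linear_combination -e2

lemma hasDerivAt_logProd {f : Fin 8 → ℝ → ℂ} {θ : Fin 8 → ℂ} {t : ℝ}
    (h : ∀ k, HasDerivAt (f k) (θ k * f k t) t) (s : Finset (Fin 8)) :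
    HasDerivAt (fun x => ∏ k ∈ s, f k x) ((∑ k ∈ s, θ k) * ∏ k ∈ s, f k t) t := by
  induction s using Finset.induction_on with
  | empty => simpa using hasDerivAt_const t (1 : ℂ)
  | insert a s ha ih =>
    simp only [Finset.prod_insert ha, Finset.sum_insert ha]
    exact HasDerivAt.congr_deriv (f := fun x => f a x * ∏ k ∈ s, f k x) ((h a).mul ih) (by ring)

lemma hasDerivAt_unitProd {ν : Fin 8} {g : ℝ → Fin 8 → ℂ} {g' : Fin 8 → ℂ} {t : ℝ}
    (hg : ∀ k, HasDerivAt (fun s => g s k) (g' k) t)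
    (h : ∀ k, k ≠ ν → k ≠ ν + 1 → g t k ≠ 0) (c : Fin 8 → ℤ) :
    HasDerivAt (fun s => ∏ k, if k = ν ∨ k = ν + 1 then (1 : ℂ) else (g s k / (‖g s k‖ : ℂ)) ^ c k)
      ((∑ k, if k = ν ∨ k = ν + 1 then (0 : ℂ) else Complex.I * (c k * (g' k / g t k).im : ℝ)) *
        ∏ k, if k = ν ∨ k = ν + 1 then (1 : ℂ) else (g t k / (‖g t k‖ : ℂ)) ^ c k) t := by
  refine hasDerivAt_logProd
    (f := fun k s => if k = ν ∨ k = ν + 1 then (1 : ℂ) else (g s k / (‖g s k‖ : ℂ)) ^ c k)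
    (θ := fun k => if k = ν ∨ k = ν + 1 then (0 : ℂ) else Complex.I * (c k * (g' k / g t k).im : ℝ))
    (fun k => ?_) Finset.univ
  by_cases hk : k = ν ∨ k = ν + 1
  · simpa only [hk, if_true, zero_mul] using hasDerivAt_const t (1 : ℂ)
  · simp only [hk, if_false]
    push Not at hk
    have h0 := h k hk.1 hk.2
    have hn : (‖g t k‖ : ℂ) ≠ 0 := by simpa using h0
    have hu : g t k / (‖g t k‖ : ℂ) ≠ 0 := div_ne_zero h0 (by simpa using h0)
    have := (hasDerivAt_zpow (c k) _ (Or.inl hu)).comp t (hasDerivAt_unit (hg k) h0)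
    refine HasDerivAt.congr_deriv (f := fun s => (g s k / (‖g s k‖ : ℂ)) ^ c k) this ?_
    rw [zpow_sub_one₀ hu]
    push_cast
    field_simp

lemma im_identity (z v w P : ℂ) (a b : ℝ) (hP : ‖P‖ = 1) (V W : ℂ)
    (hV : V = v * P + z * (Complex.I * a * P)) (hW : W = w * P + z * (Complex.I * b * P)) :
    V.re * W.im - V.im * W.re = (v.re * w.im - v.im * w.re) +
      (b * (z.re * v.re + z.im * v.im) - a * (z.re * w.re + z.im * w.im)) := by
  have hP2 : P.re * P.re + P.im * P.im = 1 := by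
    rw [← Complex.normSq_apply, Complex.normSq_eq_norm_sq, hP]; norm_num
  subst hV hW
  simp
  linear_combination ((v.re * w.im - v.im * w.re) +
      (b * (z.re * v.re + z.im * v.im) - a * (z.re * w.re + z.im * w.im))) * hP2

lemma im_identity' {z : ℂ} (hz : z ≠ 0) (v w : ℂ) : v.re * w.im - v.im * w.re =
    (w / z).im * (z.re * v.re + z.im * v.im) - (v / z).im * (z.re * w.re + z.im * w.im) := by
  have hz2 : z.re * z.re + z.im * z.im ≠ 0 := by
    rw [← Complex.normSq_apply]; simpa using hz
  simp only [Complex.div_im, Complex.normSq_apply]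
  generalize hN : z.re * z.re + z.im * z.im = N at *
  field_simp
  rw [← hN]
  ring

lemma fderiv_chartUp {V : Type} [NormedAddCommGroup V] [NormedSpace ℝ V] {ν : Fin 8}
    {c : V → Fin 8 → ℂ} {x : V} (hc : DifferentiableAt ℝ c x)
    (h : ∀ k, k ≠ ν → k ≠ ν + 1 → c x k ≠ 0) (v : V) :
    ∃ P Q : ℂ, P = (∏ k, if k = ν ∨ k = ν + 1 then (1 : ℂ) else
        (c x k / (‖c x k‖ : ℂ)) ^ coefA ν k) ∧
      Q = (∏ k, if k = ν ∨ k = ν + 1 then (1 : ℂ) else (c x k / (‖c x k‖ : ℂ)) ^ coefB ν k) ∧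
      (fderiv ℝ (fun y => chartUp ν (c y)) x v).1 = fderiv ℝ c x v ν * P + c x ν * (Complex.I *
        ((∑ k, if k = ν ∨ k = ν + 1 then 0 else coefA ν k * (fderiv ℝ c x v k / c x k).im : ℝ) : ℂ)
          * P) ∧
      (fderiv ℝ (fun y => chartUp ν (c y)) x v).2 = fderiv ℝ c x v (ν + 1) * Q + c x (ν + 1) *
        (Complex.I * ((∑ k, if k = ν ∨ k = ν + 1 then 0 else
          coefB ν k * (fderiv ℝ c x v k / c x k).im : ℝ) : ℂ) * Q) := by
  refine ⟨_, _, rfl, rfl, ?_⟩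
  have hU : DifferentiableAt ℝ (fun y => chartUp ν (c y)) x :=
    ((contDiffAt_chartUp h).differentiableAt (by simp)).comp x hc
  have hline : HasDerivAt (fun t : ℝ => x + t • v) v 0 := by
    simpa using ((hasDerivAt_id (0 : ℝ)).smul_const v).const_add x
  have hx : x + (0 : ℝ) • v = x := by simp
  have hg : HasDerivAt (fun t : ℝ => c (x + t • v)) (fderiv ℝ c x v) 0 :=
    HasFDerivAt.comp_hasDerivAt_of_eq (0 : ℝ) hc.hasFDerivAt hline hx.symm
  have hg2 : HasDerivAt (fun t : ℝ => chartUp ν (c (x + t • v)))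
      (fderiv ℝ (fun y => chartUp ν (c y)) x v) 0 :=
    HasFDerivAt.comp_hasDerivAt_of_eq (0 : ℝ) hU.hasFDerivAt hline hx.symm
  have hk : ∀ k, HasDerivAt (fun t : ℝ => c (x + t • v) k) (fderiv ℝ c x v k) 0 :=
    hasDerivAt_pi.1 hg
  have h' : ∀ k, k ≠ ν → k ≠ ν + 1 → c (x + (0 : ℝ) • v) k ≠ 0 := by rwa [hx]
  have conv : ∀ e : Fin 8 → ℤ, (∑ k, if k = ν ∨ k = ν + 1 then (0 : ℂ) else
      Complex.I * (e k * (fderiv ℝ c x v k / c x k).im : ℝ)) = Complex.I *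
      ((∑ k, if k = ν ∨ k = ν + 1 then 0 else e k * (fderiv ℝ c x v k / c x k).im : ℝ) : ℂ) := by
    intro e
    rw [Complex.ofReal_sum, Finset.mul_sum]
    refine Finset.sum_congr rfl fun k _ => ?_
    split_ifs <;> simp
  constructor
  · have h1 := (hk ν).mul (hasDerivAt_unitProd hk h' (coefA ν))
    have h2 := (ContinuousLinearMap.fst ℝ ℂ ℂ).hasFDerivAt.comp_hasDerivAt (0 : ℝ) hg2
    have := h2.unique h1
    simp only [hx, conv] at this
    exact this
  · have h1 := (hk (ν + 1)).mul (hasDerivAt_unitProd hk h' (coefB ν))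
    have h2 := (ContinuousLinearMap.snd ℝ ℂ ℂ).hasFDerivAt.comp_hasDerivAt (0 : ℝ) hg2
    have := h2.unique h1
    simp only [hx, conv] at this
    exact this

/-- The derivative of the manifold equations along the level set. -/
lemma deriv_sq_norm {V : Type} [NormedAddCommGroup V] [NormedSpace ℝ V] (ν k : Fin 8)
    {c : V → LevelSet} {x : V} (hc : DifferentiableAt ℝ (fun y => (c y).1) x) (v : V) :
    let d := fderiv ℝ (fun y => (c y).1) x v
    let m := fun k => ((c x).1 k).re * (d k).re + ((c x).1 k).im * (d k).im
    m k = coefA ν k * m ν + coefB ν k * m (ν + 1) := by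
  intro d m
  have hline : HasDerivAt (fun t : ℝ => x + t • v) v 0 := by
    simpa using ((hasDerivAt_id (0 : ℝ)).smul_const v).const_add x
  have hx : x + (0 : ℝ) • v = x := by simp
  have hg : HasDerivAt (fun t : ℝ => (c (x + t • v)).1) d 0 :=
    HasFDerivAt.comp_hasDerivAt_of_eq (0 : ℝ) hc.hasFDerivAt hline hx.symm
  have hk : ∀ k, HasDerivAt (fun t : ℝ => ‖(c (x + t • v)).1 k‖ ^ 2) (2 * m k) 0 := by
    intro k
    have := (hasDerivAt_pi.1 hg k).norm_sq
    convert this using 1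
    rw [hx, Complex.inner]
    simp [m]
    ring
  have h2 := (((hk ν).const_mul (coefA ν k : ℝ)).add ((hk (ν + 1)).const_mul (coefB ν k : ℝ))).add_const
    (coefD ν k : ℝ)
  have h3 : (fun t : ℝ => ‖(c (x + t • v)).1 k‖ ^ 2) = fun t : ℝ => coefA ν k *
      ‖(c (x + t • v)).1 ν‖ ^ 2 + coefB ν k * ‖(c (x + t • v)).1 (ν + 1)‖ ^ 2 + coefD ν k := by
    funext t
    exact sq_norm_of_mem ν k (c (x + t • v)).2
  have h4 := hk k
  rw [h3] at h4
  have := h4.unique h2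
  linarith

/-- The characterization `τ^* ω = κ^* ω_st` of the reduced form, with the quotient map `τ` and the inclusion
`κ` of the level set, where the tangent vectors of the level set `ℒ⁻¹(0)` are written as derivatives of
differentiable maps into it. -/
theorem reducedForm_pullback {V : Type} [NormedAddCommGroup V] [NormedSpace ℝ V]
    (c : V → LevelSet) (x : V) (hc : DifferentiableAt ℝ (fun y => (c y).1) x) (v w : V) :
    omega.toFun (toM (c x)) (mfderiv 𝓘(ℝ, V) 𝓘(ℝ, ℂ × ℂ) (fun y => toM (c y)) x v)
      (mfderiv 𝓘(ℝ, V) 𝓘(ℝ, ℂ × ℂ) (fun y => toM (c y)) x w) =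
    stdForm 8 (fderiv ℝ (fun y => (c y).1) x v) (fderiv ℝ (fun y => (c y).1) x w) := by
  obtain ⟨ν, hν⟩ : ∃ ν, ν = chartIndex (toM (c x)) := ⟨_, rfl⟩
  have hz : ∀ k, k ≠ ν → k ≠ ν + 1 → (c x).1 k ≠ 0 :=
    hν ▸ mem_chart_source_chartIndex (toM (c x))
  have hcont : ContinuousAt (fun y => toM (c y)) x :=
    continuous_toM.continuousAt.comp (Topology.IsInducing.subtypeVal.continuousAt_iff.2 hc.continuousAt)
  have hU : DifferentiableAt ℝ (fun y => chartUp ν (c y).1) x :=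
    DifferentiableAt.comp (g := chartUp ν) x
      ((contDiffAt_chartUp hz).differentiableAt (by simp)) hc
  have hm : MDifferentiableAt 𝓘(ℝ, V) 𝓘(ℝ, ℂ × ℂ) (fun y => toM (c y)) x := by
    rw [mdifferentiableAt_iff]
    refine ⟨hcont, ?_⟩
    subst hν
    simpa [writtenInExtChartAt, extChartAt, chartAt] using! hU.differentiableWithinAt
  have hd : ∀ u : V, mfderiv 𝓘(ℝ, V) 𝓘(ℝ, ℂ × ℂ) (fun y => toM (c y)) x u =
      fderiv ℝ (fun y => chartUp ν (c y).1) x u := by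
    intro u
    subst hν
    simp only [mfderiv, hm, writtenInExtChartAt]
    simp [extChartAt, chartAt]
    rfl
  rw [hd, hd]
  refine (reducedForm_apply (toM (c x)) _ _).trans ?_
  obtain ⟨P, Q, hP, hQ, hv1, hv2⟩ := fderiv_chartUp hc hz v
  obtain ⟨P', Q', hP', hQ', hw1, hw2⟩ := fderiv_chartUp hc hz w
  rw [← hP] at hP'
  rw [← hQ] at hQ'
  subst hP' hQ'
  rw [im_identity _ _ _ _ _ _ (hP ▸ norm_unitProd hz _) _ _ hv1 hw1,
    im_identity _ _ _ _ _ _ (hQ ▸ norm_unitProd hz _) _ _ hv2 hw2, stdForm_apply]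
  have mv := fun k => deriv_sq_norm ν k hc v
  have mw := fun k => deriv_sq_norm ν k hc w
  simp only at mv mw
  have hne := (coef_self ν).2.2.2.2.2.2
  generalize fderiv ℝ (fun y => (c y).1) x v = V at *
  generalize fderiv ℝ (fun y => (c y).1) x w = W at *
  generalize (c x).1 = z at *
  have hsum : ∀ k, (V k).re * (W k).im - (V k).im * (W k).re =
      (if k = ν then (V k).re * (W k).im - (V k).im * (W k).re else 0) +
      (if k = ν + 1 then (V k).re * (W k).im - (V k).im * (W k).re else 0) +
      (if k = ν ∨ k = ν + 1 then 0 else coefA ν k * (W k / z k).im) *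
        ((z ν).re * (V ν).re + (z ν).im * (V ν).im) -
      (if k = ν ∨ k = ν + 1 then 0 else coefA ν k * (V k / z k).im) *
        ((z ν).re * (W ν).re + (z ν).im * (W ν).im) +
      (if k = ν ∨ k = ν + 1 then 0 else coefB ν k * (W k / z k).im) *
        ((z (ν + 1)).re * (V (ν + 1)).re + (z (ν + 1)).im * (V (ν + 1)).im) -
      (if k = ν ∨ k = ν + 1 then 0 else coefB ν k * (V k / z k).im) *
        ((z (ν + 1)).re * (W (ν + 1)).re + (z (ν + 1)).im * (W (ν + 1)).im) := by
    intro k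
    by_cases e1 : k = ν
    · simp [e1, hne]
    · by_cases e2 : k = ν + 1
      · simp [e2, hne.symm]
      · simp only [e1, e2, or_self, if_false]
        rw [im_identity' (hz k e1 e2), mv k, mw k]
        ring
  rw [Finset.sum_congr rfl fun k _ => hsum k]
  simp only [Finset.sum_add_distrib, Finset.sum_sub_distrib, ← Finset.sum_mul, Finset.sum_ite_eq',
    Finset.mem_univ, if_true]
  ring

/-- In all charts, the reduced form is the standard symplectic form: `φ_ν^* ω = dx ∧ dy + du ∧ dv`.
In particular, it is smooth and closed. -/
theorem omega_chartInv {ν : Fin 8} {y : ℂ × ℂ} (hy : y ∈ chartTarget ν) (v w : ℂ × ℂ) :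
    omega.toFun (chartInv ν y) (mfderiv 𝓘(ℝ, ℂ × ℂ) 𝓘(ℝ, ℂ × ℂ) (chartInv ν) y v)
      (mfderiv 𝓘(ℝ, ℂ × ℂ) 𝓘(ℝ, ℂ × ℂ) (chartInv ν) y w) =
    (v.1.re * w.1.im - v.1.im * w.1.re) + (v.2.re * w.2.im - v.2.im * w.2.re) := by
  classical
  let c : ℂ × ℂ → LevelSet := fun y =>
    if hw : y ∈ chartTarget ν then ⟨chartSection ν y, chartSection_mem hw⟩
    else ⟨chartSection 0 0, chartSection_mem zero_mem_chartTarget⟩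
  have hc : (fun y => (c y).1) =ᶠ[nhds y] chartSection ν := by
    filter_upwards [(isOpen_chartTarget ν).mem_nhds hy] with u hu
    simp [c, hu]
  have hd := (contDiffAt_chartSection hy).differentiableAt (by simp)
  have hi : chartInv ν = fun y => toM (c y) := by
    funext u
    by_cases hu : u ∈ chartTarget ν <;> simp [chartInv, c, hu]
  rw [hi]
  refine (reducedForm_pullback c y (hd.congr_of_eventuallyEq hc) v w).trans ?_
  rw [hc.fderiv_eq, stdForm_apply]
  obtain ⟨a1, a2, a3⟩ := fderiv_chartSection hy v
  obtain ⟨b1, b2, b3⟩ := fderiv_chartSection hy w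
  rw [Fintype.sum_eq_add ν (ν + 1) (coef_self _).2.2.2.2.2.2
    (fun k hk => by rw [a3 k hk.1 hk.2, b3 k hk.1 hk.2]; ring), a1, a2, b1, b2]

/-- The function `J = |z₁|² / 2` on `ℂ⁸`. -/
def JUp (z : Fin 8 → ℂ) : ℝ := ‖z 0‖ ^ 2 / 2

/-- The function `H = |z₃|² / 2` on `ℂ⁸`. -/
def HUp (z : Fin 8 → ℂ) : ℝ := ‖z 2‖ ^ 2 / 2

/-- The functions `γ₁, γ₂, γ₃, γ₄` on `ℂ⁸`. -/
def gammaUp : Fin 4 → (Fin 8 → ℂ) → ℝ :=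
  ![fun z => 1 / 50 * (conj (z 1 * z 2 * z 3) * z 5 * z 6 * z 7).re,
    fun z => 1 / 50 * ‖z 4‖ ^ 4 * ‖z 3‖ ^ 4,
    fun z => 1 / 50 * ‖z 3‖ ^ 4 * ‖z 6‖ ^ 4,
    fun z => 1 / 100 * ‖z 4‖ ^ 4 * ‖z 6‖ ^ 4]

/-- The function `H_t = (1 - 2 t₁) H + ∑ⱼ tⱼ γⱼ` on `ℂ⁸`. -/
def HtUp (t : Fin 4 → ℝ) (z : Fin 8 → ℂ) : ℝ := (1 - 2 * t 0) * HUp z + ∑ j, t j * gammaUp j z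

lemma gammaUp_phase (j : Fin 4) (t : Torus6) (z : Fin 8 → ℂ) :
    gammaUp j (fun k => (phase t k : ℂ) * z k) = gammaUp j z := by
  fin_cases j
  · have h : conj ((phase t 1 : ℂ) * phase t 2 * phase t 3) * phase t 5 * phase t 6 * phase t 7 = 1 := by
      have h0 := prod_phase_zpow t ![0, -1, -1, -1, 0, 1, 1, 1] (by decide)
      have h1 : (phase t 1 * phase t 2 * phase t 3)⁻¹ * phase t 5 * phase t 6 * phase t 7 = 1 := by
        rw [← h0]
        simp [Fin.prod_univ_eight, mul_comm]
      have h2 := congrArg (fun c : Circle => (c : ℂ)) h1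
      simpa only [Circle.coe_mul, Circle.coe_inv_eq_conj, Circle.coe_one] using h2
    simp only [gammaUp, Fin.zero_eta, Matrix.cons_val_zero]
    congr 2
    simp only [map_mul] at h ⊢
    linear_combination (conj (z 1) * conj (z 2) * conj (z 3) * z 5 * z 6 * z 7) * h
  · exact congrArg₂ (fun x y : ℝ => 1 / 50 * x ^ 4 * y ^ 4) (norm_phase_mul t 4 (z 4)) (norm_phase_mul t 3 (z 3))
  · exact congrArg₂ (fun x y : ℝ => 1 / 50 * x ^ 4 * y ^ 4) (norm_phase_mul t 3 (z 3)) (norm_phase_mul t 6 (z 6))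
  · exact congrArg₂ (fun x y : ℝ => 1 / 100 * x ^ 4 * y ^ 4) (norm_phase_mul t 4 (z 4)) (norm_phase_mul t 6 (z 6))

/-- The function `J : M → ℝ`. -/
def J : M → ℝ := descend JUp (by intro t z; simp only [JUp, norm_phase_mul])

/-- The function `H : M → ℝ`. -/
def H : M → ℝ := descend HUp (by intro t z; simp only [HUp, norm_phase_mul])

/-- The perturbation terms `γ₁, γ₂, γ₃, γ₄ : M → ℝ`. -/
def gamma (j : Fin 4) : M → ℝ := descend (gammaUp j) (gammaUp_phase j)

/-- The function `H_t : M → ℝ`. -/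
def Ht (t : Fin 4 → ℝ) (p : M) : ℝ := (1 - 2 * t 0) * H p + ∑ j, t j * gamma j p

end Octagon

end

namespace Octagon

/-! ### Hamiltonian vector fields and brackets as directional derivatives -/

section Poisson

variable {E : Type} [NormedAddCommGroup E] [NormedSpace ℝ E] [FiniteDimensional ℝ E]
  {X : Type} [TopologicalSpace X] [ChartedSpace E X]

/-! Since `{f, J} = df(X^J)`, only the field of `J` has to be known. On `ℂ⁸` it is `-i z₁` in the
first coordinate and zero in the others (`hamiltonianVectorField_JUp`). None of the `γⱼ`, nor `H`,
involves `z₁`, so each of these functions is constant along that direction and the bracket vanishes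
(`poissonCommute_JUp`). Smoothness on `ℂ⁸` is evident, because everything is a polynomial in the `z
k` and their conjugates. It passes to `M` by composing with the smooth local sections coming from
the charts (`contMDiff_of_toM`).

The vanishing on `M` follows by symplectic reduction: `X^J` is tangent to `ℒ⁻¹(0)` and projects to
the Hamiltonian field of the induced function, so brackets with `J` may be computed upstairs. The
argument does not need a manifold structure on `ℒ⁻¹(0)`; tangent vectors are derivatives of maps `c`
from a normed space into the level set, for which `reducedForm_pullback` gives `τ^* ω = κ^* ω_st`.
The map used is `flowedSection ν` on `ℝ × ℂ²`, a chart section moved by the flow of `J`. Its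
derivative in the time direction is `X^J`, and its derivatives in the chart directions already
project onto the tangent space of `M`. These are the two properties required by
`poissonBracket_toM`, and `poissonCommute_J` puts them together. -/

lemma poissonBracket_eq_mvfderiv (Ω : NondegTwoForm E X) (f h : X → ℝ) (p : X) :
    poissonBracket Ω f h p = mvfderiv 𝓘(ℝ, E) f p (hamiltonianVectorField Ω h p) :=
  hamiltonianVectorField_spec Ω f p _

/-- Nondegeneracy leaves only one candidate, so a Hamiltonian vector field can be found by guessing
it and testing against all tangent vectors. -/
lemma eq_hamiltonianVectorField (Ω : NondegTwoForm E X) {h : X → ℝ} {p : X}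
    {v : TangentSpace 𝓘(ℝ, E) p} (hv : ∀ w, Ω.toFun p v w = mvfderiv 𝓘(ℝ, E) h p w) :
    hamiltonianVectorField Ω h p = v := by
  refine sub_eq_zero.1 ((Ω.nondegenerate p).1 _ fun w => ?_)
  rw [map_sub, LinearMap.sub_apply, hv, hamiltonianVectorField_spec, sub_self]

end Poisson

lemma mvfderiv_vectorSpace {n : ℕ} (f : (Fin n → ℂ) → ℝ) (z : Fin n → ℂ) (v : Fin n → ℂ) :
    mvfderiv 𝓘(ℝ, Fin n → ℂ) f z v = fderiv ℝ f z v := by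
  rw [mvfderiv, mfderiv_eq_fderiv]
  rfl

/-! ### Functions induced on the quotient -/

/-- A function on `M` that is induced by a smooth function on `ℂ⁸` is smooth. -/
lemma contMDiff_of_toM {f : M → ℝ} {F : (Fin 8 → ℂ) → ℝ} (hf : ∀ z : LevelSet, f (toM z) = F z.1)
    (hF : ContDiff ℝ ∞ F) : ContMDiff 𝓘(ℝ, ℂ × ℂ) 𝓘(ℝ, ℝ) ∞ f := by
  intro p
  have hp := mem_chart_source_chartIndex p
  refine (hF.contMDiff.contMDiffAt.comp p (contMDiffAt_localSection hp)).congr_of_eventuallyEq ?_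
  -- On the whole chart domain a point is the class of its representative given by the local
  -- section, so there `f` is `F` composed with that section.
  filter_upwards [(chart (chartIndex p)).open_source.mem_nhds hp] with q hq
  obtain ⟨z, rfl⟩ := toM_surjective q
  exact (congrArg f (toM_chartSection hq)).trans (hf _)

/-! ### Differentiable families of points of the level set and their projections to `M` -/

section Curves

variable {V : Type} [NormedAddCommGroup V] [NormedSpace ℝ V] {c : V → LevelSet} {x : V}

/-- Read in the preferred chart at `toM (c x)`, the projected family is `chartUp` composed with `c`,
and `chartUp` is smooth where the normalized coordinates do not vanish. -/
lemma mdifferentiableAt_toM (hc : DifferentiableAt ℝ (fun y => (c y).1) x) :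
    MDifferentiableAt 𝓘(ℝ, V) 𝓘(ℝ, ℂ × ℂ) (fun y => toM (c y)) x := by
  have hz := toM_mem_chartSource.1 (mem_chart_source_chartIndex (toM (c x)))
  have hU : DifferentiableAt ℝ (fun y => chartUp (chartIndex (toM (c x))) (c y).1) x :=
    DifferentiableAt.comp (g := chartUp _) x ((contDiffAt_chartUp hz).differentiableAt (by simp)) hc
  rw [mdifferentiableAt_iff]
  refine ⟨continuous_toM.continuousAt.comp
    (Topology.IsInducing.subtypeVal.continuousAt_iff.2 hc.continuousAt), ?_⟩
  simpa [writtenInExtChartAt, extChartAt, chartAt] using! hU.differentiableWithinAt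

lemma mfderiv_toM (hc : DifferentiableAt ℝ (fun y => (c y).1) x) (u : V) :
    mfderiv 𝓘(ℝ, V) 𝓘(ℝ, ℂ × ℂ) (fun y => toM (c y)) x u =
      fderiv ℝ (fun y => chartUp (chartIndex (toM (c x))) (c y).1) x u := by
  simp only [mfderiv, mdifferentiableAt_toM hc, writtenInExtChartAt]
  simp [extChartAt, chartAt]
  rfl

/-- This is the chain rule applied to both sides of `f ∘ toM ∘ c = F ∘ c`. It lets differentials on
`M` be evaluated upstairs, as `reducedForm_pullback` does for the form. -/
lemma mvfderiv_mfderiv_toM (hc : DifferentiableAt ℝ (fun y => (c y).1) x) {f : M → ℝ}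
    {F : (Fin 8 → ℂ) → ℝ} (hf : ∀ z : LevelSet, f (toM z) = F z.1) (hF : ContDiff ℝ ∞ F) (u : V) :
    mvfderiv 𝓘(ℝ, ℂ × ℂ) f (toM (c x))
        (mfderiv 𝓘(ℝ, V) 𝓘(ℝ, ℂ × ℂ) (fun y => toM (c y)) x u) =
      fderiv ℝ F (c x).1 (fderiv ℝ (fun y => (c y).1) x u) := by
  have hfd := (contMDiff_of_toM hf hF (toM (c x))).mdifferentiableAt (by simp)
  have h1 := mfderiv_comp x hfd (mdifferentiableAt_toM hc)
  have h2 : f ∘ (fun y => toM (c y)) = F ∘ fun y => (c y).1 := funext fun y => hf (c y)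
  rw [h2, mfderiv_eq_fderiv,
    fderiv_comp x ((hF.differentiable (by simp)).differentiableAt) hc] at h1
  exact (congrArg (fun l : V →L[ℝ] ℝ => l u) h1).symm

/-- The Poisson bracket on the quotient of two induced functions is the Poisson bracket on `ℂ⁸`, at each
point where the Hamiltonian vector field on `ℂ⁸` of the second function is tangent to a family of points
of the level set that submerges onto `M`. -/
lemma poissonBracket_toM (hc : DifferentiableAt ℝ (fun y => (c y).1) x)
    (hs : ∀ w, ∃ u, mfderiv 𝓘(ℝ, V) 𝓘(ℝ, ℂ × ℂ) (fun y => toM (c y)) x u = w) {f h : M → ℝ}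
    {F G : (Fin 8 → ℂ) → ℝ} (hf : ∀ z : LevelSet, f (toM z) = F z.1) (hF : ContDiff ℝ ∞ F)
    (hh : ∀ z : LevelSet, h (toM z) = G z.1) (hG : ContDiff ℝ ∞ G) {u : V}
    (hu : fderiv ℝ (fun y => (c y).1) x u = hamiltonianVectorField (omegaSt 8) G (c x).1) :
    poissonBracket omega f h (toM (c x)) = poissonBracket (omegaSt 8) F G (c x).1 := by
  have key : hamiltonianVectorField omega h (toM (c x)) =
      mfderiv 𝓘(ℝ, V) 𝓘(ℝ, ℂ × ℂ) (fun y => toM (c y)) x u := by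
    refine eq_hamiltonianVectorField _ fun w => ?_
    -- Every test vector is the projection of the velocity of `c` in some direction `u'`. Paired
    -- with it, both the form and the differential of `h` become expressions on `ℂ⁸`, where the
    -- defining equation of the Hamiltonian field of `G` applies.
    obtain ⟨u', rfl⟩ := hs w
    refine (reducedForm_pullback c x hc u u').trans ?_
    refine Eq.trans ?_ (mvfderiv_mfderiv_toM hc hh hG u').symm
    rw [hu]
    exact (hamiltonianVectorField_spec (omegaSt 8) G (c x).1 _).trans (mvfderiv_vectorSpace _ _ _)
  rw [poissonBracket_eq_mvfderiv, poissonBracket_eq_mvfderiv, key, mvfderiv_mfderiv_toM hc hf hF, hu]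
  exact (mvfderiv_vectorSpace _ _ _).symm

end Curves

/-! ### The Hamiltonian flow of `J` -/

lemma contDiff_JUp : ContDiff ℝ ∞ JUp :=
  ((contDiff_apply ℝ ℂ 0).norm_sq ℝ).div_const 2

lemma fderiv_JUp (z w : Fin 8 → ℂ) :
    fderiv ℝ JUp z w = (z 0).re * (w 0).re + (z 0).im * (w 0).im := by
  have h1 : HasFDerivAt (fun y : Fin 8 → ℂ => y 0)
      (ContinuousLinearMap.proj (R := ℝ) (φ := fun _ : Fin 8 => ℂ) 0) z :=
    (ContinuousLinearMap.proj (R := ℝ) (φ := fun _ : Fin 8 => ℂ) 0).hasFDerivAt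
  have h2 := h1.norm_sq.mul_const (1 / 2 : ℝ)
  have h3 : JUp = fun y => ‖y 0‖ ^ 2 * (1 / 2 : ℝ) := by funext y; simp only [JUp]; ring
  rw [h3, h2.fderiv]
  simp [Complex.inner]
  ring

/-- The convention `Ω (X^f, ·) = df` makes the flow of `J` rotate `z₁` clockwise; this explains the
minus signs in the exponentials below. -/
lemma hamiltonianVectorField_JUp (z : Fin 8 → ℂ) :
    hamiltonianVectorField (omegaSt 8) JUp z = Pi.single 0 (-Complex.I * z 0) := by
  refine eq_hamiltonianVectorField _ fun w => ?_
  refine Eq.trans ?_ ((mvfderiv_vectorSpace _ _ _).trans (fderiv_JUp z w)).symm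
  refine (stdForm_apply _ _).trans ?_
  rw [Finset.sum_eq_single 0 (fun k _ hk => by simp [hk]) (by simp)]
  simp
  ring

/-- Functions on `ℂ⁸` that do not depend on `z₁` Poisson commute with `J`. -/
lemma poissonCommute_JUp {F : (Fin 8 → ℂ) → ℝ} (hF : ContDiff ℝ ∞ F)
    (h : ∀ z a, F (Function.update z 0 a) = F z) : PoissonCommute (omegaSt 8) F JUp := by
  intro z
  rw [poissonBracket_eq_mvfderiv, hamiltonianVectorField_JUp]
  refine (mvfderiv_vectorSpace _ _ _).trans ?_
  set v : Fin 8 → ℂ := Pi.single 0 (-Complex.I * z 0)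
  -- The straight line with velocity `X^J` suffices in place of the flow: only its first coordinate
  -- moves, so `F` is constant on it.
  have hline : HasDerivAt (fun t : ℝ => z + t • v) v 0 := by
    simpa using ((hasDerivAt_id (0 : ℝ)).smul_const v).const_add z
  have h1 := HasFDerivAt.comp_hasDerivAt_of_eq (0 : ℝ)
    ((hF.differentiable (by simp)).differentiableAt (x := z)).hasFDerivAt hline (by simp)
  have h2 : (F ∘ fun t : ℝ => z + t • v) = fun _ => F z := by
    funext t
    -- Replacing the first coordinate of `z` by that of the point on the line yields exactly the
    -- point on the line.
    rw [Function.comp, ← h z ((z + t • v) 0)]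
    congr 1
    funext k
    by_cases hk : k = 0
    · subst hk; simp
    · simp [hk, v]
  rw [h2] at h1
  exact h1.unique (hasDerivAt_const 0 _)

/-! ### Rotated chart sections and descent of the bracket to `M` -/

/-- The level set is defined through the moduli `‖z k‖` alone, so it is preserved by the flow of
`J`. -/
lemma momentL_rotate {z : Fin 8 → ℂ} (hz : momentL z = 0) (a : ℂ) (ha : ‖a‖ = 1) :
    momentL (fun k => if k = 0 then a * z k else z k) = 0 := by
  rw [← hz]
  funext j
  have : ∀ k, ‖if k = 0 then a * z k else z k‖ = ‖z k‖ := by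
    intro k; split_ifs <;> simp [ha]
  simp only [momentL, this]

open Classical in
/-- The points of `ℒ⁻¹(0)` obtained from the representatives given by the chart `φ_ν` by the flow of `J`. -/
noncomputable def flowedSection (ν : Fin 8) (y : ℝ × (ℂ × ℂ)) : LevelSet :=
  if hw : y.2 ∈ chartTarget ν then
    -- Index `0` may be one of the two chart coordinates or one of the positive ones; the rotation
    -- is the same in both cases.
    ⟨_, momentL_rotate (chartSection_mem hw) (Complex.exp ((-y.1 : ℝ) * Complex.I))
      (Complex.norm_exp_ofReal_mul_I _)⟩
  -- An arbitrary point of the level set: the chart target is open, so this value does not affect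
  -- derivatives at its points.
  else ⟨chartSection 0 0, chartSection_mem zero_mem_chartTarget⟩

lemma flowedSection_apply {ν : Fin 8} {y : ℝ × (ℂ × ℂ)} (hy : y.2 ∈ chartTarget ν) (k : Fin 8) :
    (flowedSection ν y).1 k = if k = 0 then Complex.exp ((-y.1 : ℝ) * Complex.I) *
      chartSection ν y.2 k else chartSection ν y.2 k := by
  simp only [flowedSection, hy, dif_pos]

lemma flowedSection_zero {ν : Fin 8} {y : ℂ × ℂ} (hy : y ∈ chartTarget ν) :
    (flowedSection ν (0, y)).1 = chartSection ν y := by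
  funext k
  rw [flowedSection_apply hy]
  simp

lemma differentiableAt_flowedSection {ν : Fin 8} {y : ℝ × (ℂ × ℂ)} (hy : y.2 ∈ chartTarget ν) :
    DifferentiableAt ℝ (fun y => (flowedSection ν y).1) y := by
  refine differentiableAt_pi.2 fun k => ?_
  have hsec : DifferentiableAt ℝ (fun y : ℝ × (ℂ × ℂ) => chartSection ν y.2 k) y :=
    (differentiableAt_pi.1 ((contDiffAt_chartSection hy).differentiableAt (by simp)) k).comp y
      differentiableAt_snd
  have hexp : DifferentiableAt ℝ
      (fun y : ℝ × (ℂ × ℂ) => Complex.exp ((-y.1 : ℝ) * Complex.I)) y :=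
    ((Complex.ofRealCLM.differentiableAt.comp y differentiableAt_fst.neg).mul_const _).cexp
  have hev : (fun y => (flowedSection ν y).1 k) =ᶠ[nhds y] fun y =>
      if k = 0 then Complex.exp ((-y.1 : ℝ) * Complex.I) * chartSection ν y.2 k
        else chartSection ν y.2 k := by
    filter_upwards [continuousAt_snd.preimage_mem_nhds ((isOpen_chartTarget ν).mem_nhds hy)] with u hu
    exact flowedSection_apply hu k
  refine DifferentiableAt.congr_of_eventuallyEq ?_ hev
  split_ifs
  · exact hexp.mul hsec
  · exact hsec

/-- Differentiating `exp (-i t) z₁` at `t = 0` gives `-i z₁`: the time direction of the family is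
the Hamiltonian field of `J`. -/
lemma fderiv_flowedSection {ν : Fin 8} {y : ℂ × ℂ} (hy : y ∈ chartTarget ν) :
    fderiv ℝ (fun y => (flowedSection ν y).1) (0, y) (1, 0) =
      Pi.single 0 (-Complex.I * chartSection ν y 0) := by
  have hline : HasDerivAt (fun t : ℝ => ((t, y) : ℝ × (ℂ × ℂ))) (1, 0) 0 :=
    (hasDerivAt_id (0 : ℝ)).prodMk (hasDerivAt_const 0 y)
  have h1 := HasFDerivAt.comp_hasDerivAt (0 : ℝ)
    (differentiableAt_flowedSection (y := (0, y)) hy).hasFDerivAt hline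
  refine h1.unique (hasDerivAt_pi.2 fun k => ?_)
  -- The chart coordinates are fixed along this line, so the explicit formula holds for all `t` and
  -- not only near `0`.
  have h2 : (fun t : ℝ => ((fun y => (flowedSection ν y).1) ∘ fun t : ℝ => (t, y)) t k) = fun t : ℝ =>
      if k = 0 then Complex.exp ((-t : ℝ) * Complex.I) * chartSection ν y k
        else chartSection ν y k :=
    funext fun t => flowedSection_apply (y := (t, y)) hy k
  rw [h2]
  by_cases hk : k = 0
  · subst hk
    simp only [if_true, Pi.single_eq_same]
    have h3 := (((hasDerivAt_id (0 : ℝ)).neg.ofReal_comp.mul_const Complex.I).cexp).mul_const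
      (chartSection ν y 0)
    exact HasDerivAt.congr_deriv (f := fun t : ℝ => Complex.exp ((-t : ℝ) * Complex.I) *
      chartSection ν y 0) h3 (by simp)
  · simpa [hk] using hasDerivAt_const (0 : ℝ) (chartSection ν y k)

/-- If a function on `ℂ⁸` Poisson commutes with `J` then so does the function that it induces on `M`. -/
lemma poissonCommute_J {f : M → ℝ} {F : (Fin 8 → ℂ) → ℝ} (hf : ∀ z : LevelSet, f (toM z) = F z.1)
    (hF : ContDiff ℝ ∞ F) (h : PoissonCommute (omegaSt 8) F JUp) : PoissonCommute omega f J := by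
  intro p
  obtain ⟨ν, hν⟩ : ∃ ν, ν = chartIndex p := ⟨_, rfl⟩
  have hp : p ∈ (chart ν).source := hν ▸ mem_chart_source_chartIndex p
  obtain ⟨y, hy⟩ : ∃ y, y = chart ν p := ⟨_, rfl⟩
  have hmem : y ∈ chartTarget ν := hy ▸ (chart ν).map_source hp
  -- At time zero the family is the chart section, hence it passes through a representative of `p`.
  have hpt : toM (flowedSection ν (0, y)) = p := by
    have h1 : flowedSection ν (0, y) = ⟨chartSection ν y, chartSection_mem hmem⟩ :=
      Subtype.ext (flowedSection_zero hmem)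
    rw [h1, ← chartInv_of_mem hmem, hy]
    exact (chart ν).left_inv hp
  have hc := differentiableAt_flowedSection (y := (0, y)) hmem
  rw [← hpt, poissonBracket_toM hc ?_ hf hF (fun z => rfl) contDiff_JUp (u := (1, 0)) ?_]
  · exact h _
  · intro w
    -- Tangent vectors at `p` are read in the chart with the preferred index `ν`. At time zero the
    -- family is a section of this chart, so `chartUp ν` undoes it and the direction `(0, w)`
    -- projects to `w`.
    refine ⟨(0, w), ?_⟩
    rw [mfderiv_toM hc, hpt, ← hν]
    have hz : ∀ k, k ≠ ν → k ≠ ν + 1 → (flowedSection ν (0, y)).1 k ≠ 0 := by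
      rw [flowedSection_zero hmem]
      exact chartSection_ne_zero hmem
    have hU : DifferentiableAt ℝ (fun y => chartUp ν (flowedSection ν y).1) ((0 : ℝ), y) :=
      DifferentiableAt.comp (g := chartUp ν) _
        ((contDiffAt_chartUp hz).differentiableAt (by simp)) hc
    have h1 := hU.hasFDerivAt.comp y (hasFDerivAt_prodMk_right (𝕜 := ℝ) (0 : ℝ) y)
    have h2 : ((fun y => chartUp ν (flowedSection ν y).1) ∘ fun y => ((0 : ℝ), y)) =ᶠ[nhds y] id := by
      filter_upwards [(isOpen_chartTarget ν).mem_nhds hmem] with u hu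
      simp only [Function.comp, flowedSection_zero hu, chartUp_chartSection hu, id]
    have h3 := (h1.congr_of_eventuallyEq h2.symm).unique (hasFDerivAt_id y)
    exact congrArg (fun l : ℂ × ℂ →L[ℝ] ℂ × ℂ => l w) h3
  · rw [hamiltonianVectorField_JUp, fderiv_flowedSection hmem, flowedSection_zero hmem]

/-! ### The functions `γⱼ` and `H_t` -/

/-- The norm is not smooth at zero, but its fourth power is the square of the smooth function `‖z k‖
^ 2`. -/
lemma contDiff_norm_pow_four (k : Fin 8) : ContDiff ℝ ∞ fun z : Fin 8 → ℂ => ‖z k‖ ^ 4 := by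
  have h := ((contDiff_apply ℝ ℂ k).norm_sq ℝ (n := ∞)).pow 2
  simpa only [← pow_mul] using h

lemma contDiff_gammaUp (j : Fin 4) : ContDiff ℝ ∞ (gammaUp j) := by
  have ha : ∀ k : Fin 8, ContDiff ℝ ∞ fun z : Fin 8 → ℂ => z k := fun k => contDiff_apply ℝ ℂ k
  have hn := contDiff_norm_pow_four
  fin_cases j
  · exact contDiff_const.mul (Complex.reCLM.contDiff.comp
      ((((Complex.conjCLE.contDiff.comp (((ha 1).mul (ha 2)).mul (ha 3))).mul (ha 5)).mul
        (ha 6)).mul (ha 7)))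
  · exact (contDiff_const.mul (hn 4)).mul (hn 3)
  · exact (contDiff_const.mul (hn 3)).mul (hn 6)
  · exact (contDiff_const.mul (hn 4)).mul (hn 6)

lemma contDiff_HtUp (t : Fin 4 → ℝ) : ContDiff ℝ ∞ (HtUp t) :=
  (contDiff_const.mul (((contDiff_apply ℝ ℂ 2).norm_sq ℝ).div_const 2)).add
    (ContDiff.sum fun j _ => contDiff_const.mul (contDiff_gammaUp j))

/-- Besides smoothness, independence of `z₁` is the only property of the `γⱼ` that enters the
vanishing of the brackets upstairs. -/
lemma gammaUp_update (j : Fin 4) (z : Fin 8 → ℂ) (a : ℂ) :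
    gammaUp j (Function.update z 0 a) = gammaUp j z := by
  fin_cases j <;> simp [gammaUp]

lemma HtUp_update (t : Fin 4 → ℝ) (z : Fin 8 → ℂ) (a : ℂ) :
    HtUp t (Function.update z 0 a) = HtUp t z := by
  simp [HtUp, HUp, gammaUp_update]

end Octagon

theorem mainTheorem5 :
    -- the functions on the symplectic quotient `M` are smooth
    (∀ j : Fin 4, ContMDiff 𝓘(ℝ, ℂ × ℂ) 𝓘(ℝ, ℝ) ∞ (Octagon.gamma j)) ∧
    ContMDiff 𝓘(ℝ, ℂ × ℂ) 𝓘(ℝ, ℝ) ∞ Octagon.J ∧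
    (∀ t : Fin 4 → ℝ, ContMDiff 𝓘(ℝ, ℂ × ℂ) 𝓘(ℝ, ℝ) ∞ (Octagon.Ht t)) ∧
    -- they Poisson commute with `J` on `M`
    (∀ j : Fin 4, Octagon.PoissonCommute Octagon.omega (Octagon.gamma j) Octagon.J) ∧
    (∀ t : Fin 4 → ℝ, Octagon.PoissonCommute Octagon.omega (Octagon.Ht t) Octagon.J) ∧
    -- the same holds for the functions on `ℂ⁸` with its standard symplectic form
    (∀ j : Fin 4, ContDiff ℝ ∞ (Octagon.gammaUp j)) ∧
    ContDiff ℝ ∞ Octagon.JUp ∧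
    (∀ t : Fin 4 → ℝ, ContDiff ℝ ∞ (Octagon.HtUp t)) ∧
    (∀ j : Fin 4, Octagon.PoissonCommute (Octagon.omegaSt 8) (Octagon.gammaUp j) Octagon.JUp) ∧
    (∀ t : Fin 4 → ℝ, Octagon.PoissonCommute (Octagon.omegaSt 8) (Octagon.HtUp t) Octagon.JUp) := by
  open Octagon in
  -- Descended functions evaluate definitionally on classes `toM z`, so compatibility with the
  -- functions on `ℂ⁸` is `rfl` throughout, also for the combination `Ht t`.
  exact ⟨fun j => contMDiff_of_toM (fun _ => rfl) (contDiff_gammaUp j),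
    contMDiff_of_toM (fun _ => rfl) contDiff_JUp,
    fun t => contMDiff_of_toM (fun _ => rfl) (contDiff_HtUp t),
    fun j => poissonCommute_J (fun _ => rfl) (contDiff_gammaUp j)
      (poissonCommute_JUp (contDiff_gammaUp j) (gammaUp_update j)),
    fun t => poissonCommute_J (fun _ => rfl) (contDiff_HtUp t)
      (poissonCommute_JUp (contDiff_HtUp t) (HtUp_update t)),
    contDiff_gammaUp, contDiff_JUp, contDiff_HtUp,
    fun j => poissonCommute_JUp (contDiff_gammaUp j) (gammaUp_update j),
    fun t => poissonCommute_JUp (contDiff_HtUp t) (HtUp_update t)⟩
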